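/- **Setting.** Processes $1,\dots,n$ with initial values $v_1,\dots,v_n\in\mathbb R$ communicate asynchronously along the edges of a graph $G$; there is also a trusted process, the only holder of the secret key of a homomorphic encryption scheme on vectors of $\mathbb R^n$ whose public key everybody knows. Messages can be read only by their receivers. With $\mu=\frac1n\sum_i v_i$, $\sigma^2=\frac1n\sum_i(v_i-\mu)^2$ and a parameter $c\in\mathbb R$, process $k$ holds an *outlier* if $|v_k-\mu|>c\sigma$. All processes (the trusted one included) follow the outlier-resistant consensus algorithm, which has three rounds. In rounds 1, 2 and 3 process $i$ uses the initial value $v_i$, $(v_i-\mu)^2$, and the pair $(v_i,1)$, or $(0,0)$ if it holds an outlier, respectively. In each round it starts with *Votes* $=\mathrm{Enc}(0,\dots,x_i,\dots,0)$, where $x_i$ is its initial value of the round (in round 3: *Votes* and *Participating*, for the two entries of the pair), and with the plaintext vector *Counts* $=(0,\dots,1,\dots,0)$, and sends these to its neighbours. When it receives such a message, it ignores it if the process has already carried out the Prepare phase of the round or if every nonzero entry of the received *Counts* is nonzero in its own *Counts*; otherwise it adds the received vectors to its own and sends the result to its neighbours, and if no entry of *Counts* is zero any more, it carries out the Prepare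 phase (multiply slot $j$ of each ciphertext by $1/(n\,\mathit{Counts}_j)$ and add up all $n$ rotations) and sends the outcome to the trusted process. The trusted process decrypts what it is sent and announces the result to all processes. So the announced results are $\mu$, $\sigma^2$, $\frac1n\sum_{i\notin \mathrm{Outliers}}v_i$ and $\frac1n\sum_{i\notin\mathrm{Outliers}}1$. Encryption is idealized: it is exact and randomized, everybody can encrypt with randomness of its own and apply the homomorphic operations, ciphertexts can be compared for equality up to the algebraic identities of these operations, and only the trusted process can decrypt. The *view* of a process consists of its initial value (if it has one), everything it has received, and its own random strings. Two views are *indistinguishable* for it if they look alike apart from ciphertexts and decrypted values, and if every comparison of two plaintexts or of two ciphertexts that it can compute from its view has the same outcome on both. A process has *learned* a property of $(v_1,\dots,v_n)$ at some time of an execution if the property holds for the initial values of every (partial) execution of the algorithm in which its view is indistinguishable from its present one. **Theorem.** Consider any time of any execution on the initial values $v$, and let $o$ be any process, possibly the trusted one. 1. If some process $j\ne o$ holds an outlier and some process $k\neq o$ does not, then $o$ has learned neither that $j$ holds an outlier nor that $k$ does not. 2. For every permutation $\pi$ of $\{1,\dots,n\}$ (with $\pi(o)=o$ unless $o$ is the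 trusted process), $o$ cannot exclude that the set of processes holding outliers is $\{j : v_{\pi(j)}\text{ is an outlier of }v\}$. 3. Every property of the initial values that $o$ has learned holds for all $w\in\mathbb R^n$ which have the same four announced results as $v$ and, unless $o$ is the trusted process, satisfy $w_o=v_o$. -/

import Mathlib

namespace OutlierConsensus

/-! ### Statistics of the initial values and outliers -/

/-- Real vectors with one slot per participating process. -/
abbrev Vec (n : ℕ) := Fin n → ℝ

/-- The average of the entries of a vector. -/
noncomputable def mean {n : ℕ} (v : Vec n) : ℝ := (∑ i, v i) / n

/-- The average squared deviation from the mean. -/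
noncomputable def variance {n : ℕ} (v : Vec n) : ℝ := mean fun i => (v i - mean v) ^ 2

/-- The standard deviation. -/
noncomputable def stdDev {n : ℕ} (v : Vec n) : ℝ := √(variance v)

/-- Process `k` holds an outlier: its value lies outside `μ ± c σ`. -/
def IsOutlier {n : ℕ} (c : ℝ) (v : Vec n) (k : Fin n) : Prop :=
  c * stdDev v < |v k - mean v|

open Classical in
/-- `(1 / n) ∑ v i` over the processes that hold no outlier. -/
noncomputable def keptMean {n : ℕ} (c : ℝ) (v : Vec n) : ℝ :=
  mean fun i => if IsOutlier c v i then 0 else v i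

open Classical in
/-- `(1 / n) ∑ 1` over the processes that hold no outlier. -/
noncomputable def keptFraction {n : ℕ} (c : ℝ) (v : Vec n) : ℝ :=
  mean fun i => if IsOutlier c v i then 0 else 1

/-- `v` and `w` lead to the same values of the four averages the algorithm announces. -/
def SameResults {n : ℕ} (c : ℝ) (v w : Vec n) : Prop :=
  mean v = mean w ∧ variance v = variance w ∧
    keptMean c v = keptMean c w ∧ keptFraction c v = keptFraction c w

/-! ### Idealized homomorphic encryption -/

/-- The agents: `some i` is the participating process `i`, and `none` is the trusted process, the
only holder of the secret key. -/
abbrev Agent (n : ℕ) := Option (Fin n)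

/-- Ciphertexts under the public key of the trusted process. Encryption is randomized:
`enc x a r` is the encryption of `x` by agent `a` with its `r`-th random string. The other
constructors are the homomorphic operations, which anybody can apply. -/
inductive Cipher (n : ℕ) : Type
  | enc (x : Vec n) (a : Agent n) (r : ℕ)
  | add (e f : Cipher n)
  | addPlain (e : Cipher n) (x : Vec n)
  | mul (e f : Cipher n)
  | mulPlain (e : Cipher n) (x : Vec n)
  | rotate (e : Cipher n) (k : ℕ)

/-- Cyclic rotation to the left by `k` slots. -/
def rotVec {n : ℕ} (k : ℕ) (x : Vec n) : Vec n :=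
  fun j => x ⟨(j + k) % n, Nat.mod_lt _ j.pos⟩

/-- Decryption: the plaintext vector underlying a ciphertext. -/
def Cipher.dec {n : ℕ} : Cipher n → Vec n
  | enc x _ _ => x
  | add e f => e.dec + f.dec
  | addPlain e x => e.dec + x
  | mul e f => e.dec * f.dec
  | mulPlain e x => e.dec * x
  | rotate e k => rotVec k e.dec

/-- Two ciphertext expressions denote the same ciphertext: the algebraic identities between
homomorphic operations, which an agent can observe by comparing ciphertexts without decrypting. -/
inductive Cipher.Same {n : ℕ} : Cipher n → Cipher n → Prop
  | refl (e) : Same e e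
  | symm {e f} : Same e f → Same f e
  | trans {e f g} : Same e f → Same f g → Same e g
  | add_congr {e e' f f'} : Same e e' → Same f f' → Same (add e f) (add e' f')
  | addPlain_congr {e e'} (x) : Same e e' → Same (addPlain e x) (addPlain e' x)
  | mul_congr {e e' f f'} : Same e e' → Same f f' → Same (mul e f) (mul e' f')
  | mulPlain_congr {e e'} (x) : Same e e' → Same (mulPlain e x) (mulPlain e' x)
  | rotate_congr {e e'} (k) : Same e e' → Same (rotate e k) (rotate e' k)
  | add_comm (e f) : Same (add e f) (add f e)
  | add_assoc (e f g) : Same (add (add e f) g) (add e (add f g))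
  | mul_comm (e f) : Same (mul e f) (mul f e)
  | mul_assoc (e f g) : Same (mul (mul e f) g) (mul e (mul f g))
  | mul_add (e f g) : Same (mul e (add f g)) (add (mul e f) (mul e g))
  | enc_addPlain (x a r y) : Same (addPlain (enc x a r) y) (enc (x + y) a r)
  | add_addPlain (e f x) : Same (addPlain (add e f) x) (add e (addPlain f x))
  | addPlain_addPlain (e x y) : Same (addPlain (addPlain e x) y) (addPlain e (x + y))
  | addPlain_zero (e) : Same (addPlain e 0) e
  | mulPlain_add (e f x) : Same (mulPlain (add e f) x) (add (mulPlain e x) (mulPlain f x))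
  | mulPlain_addPlain (e x y) :
      Same (mulPlain (addPlain e x) y) (addPlain (mulPlain e y) (x * y))
  | mulPlain_mul (e f x) : Same (mulPlain (mul e f) x) (mul e (mulPlain f x))
  | mulPlain_mulPlain (e x y) : Same (mulPlain (mulPlain e x) y) (mulPlain e (x * y))
  | mulPlain_plain_add (e x y) :
      Same (mulPlain e (x + y)) (add (mulPlain e x) (mulPlain e y))
  | mulPlain_one (e) : Same (mulPlain e 1) e
  | rotate_add (e f k) : Same (rotate (add e f) k) (add (rotate e k) (rotate f k))
  | rotate_addPlain (e x k) :
      Same (rotate (addPlain e x) k) (addPlain (rotate e k) (rotVec k x))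
  | rotate_mul (e f k) : Same (rotate (mul e f) k) (mul (rotate e k) (rotate f k))
  | rotate_mulPlain (e x k) :
      Same (rotate (mulPlain e x) k) (mulPlain (rotate e k) (rotVec k x))
  | rotate_rotate (e k l) : Same (rotate (rotate e k) l) (rotate e (k + l))
  | rotate_zero (e) : Same (rotate e 0) e

/-! ### Messages and states -/

/-- The three rounds: mean, standard deviation, mean without outliers. -/
inductive Round : Type
  | avg
  | dev
  | final
  deriving DecidableEq

/-- Index of the random string that encrypts *Votes* in a round. -/
def Round.nonce : Round → ℕ
  | avg => 0
  | dev => 1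
  | final => 2

/-- The part of a message that is neither a ciphertext nor a decrypted result. `gossip` messages
travel between neighbours and carry the plaintext vector *Counts*; `prepared` messages carry the
output of the Prepare phase to the trusted process; `result` messages announce what the trusted
process has decrypted. -/
inductive Header (n : ℕ) : Type
  | gossip (ρ : Round) (counts : Fin n → ℕ)
  | prepared (ρ : Round)
  | result (ρ : Round)

/-- A message: header, ciphertexts, plaintext vectors. The ciphertexts are `[Votes]` in the first
two rounds and `[Votes, Participating]` in the last one. -/
structure Msg (n : ℕ) : Type where
  header : Header n
  ciphers : List (Cipher n)
  plains : List (Vec n)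

/-- A message with its sender and its receiver. -/
structure Packet (n : ℕ) : Type where
  src : Agent n
  dst : Agent n
  msg : Msg n

/-- Local variables of a process for one round. -/
structure RoundState (n : ℕ) : Type where
  /-- `[Votes]`, or `[Votes, Participating]` in the last round -/
  ciphers : List (Cipher n)
  counts : Fin n → ℕ
  /-- the Prepare phase of this round has been carried out -/
  decided : Bool

/-- Local state of a participating process; `rounds ρ = none` before it starts round `ρ`. -/
structure ProcState (n : ℕ) : Type where
  rounds : Round → Option (RoundState n)
  /-- the mean announced after the first round -/
  mean : ℝ
  /-- the value decided at the end -/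
  decision : Option ℝ

/-- What an agent can witness. Messages are encrypted for their receiver, so nobody else sees their
contents. A message is seen when it arrives, possibly before the algorithm is ready to use it. -/
inductive Event (n : ℕ) : Type
  | start
  | arrive (p : Packet n)
  | consume (p : Packet n)

/-- Global state of the system. -/
structure State (n : ℕ) : Type where
  procs : Fin n → ProcState n
  /-- messages in transit -/
  net : Multiset (Packet n)
  /-- messages that have arrived but have not been handled yet -/
  inbox : Agent n → Multiset (Packet n)
  /-- everything each agent has witnessed so far, in order -/
  log : Agent n → List (Event n)

/-- Nothing has happened yet. -/
def State.initial (n : ℕ) : State n where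
  procs := fun _ => ⟨fun _ => none, 0, none⟩
  net := 0
  inbox := fun _ => 0
  log := fun _ => []

/-! ### The algorithm -/

/-- Variables at the start of a round: for each initial value `x` in `xs`, an encryption of
`[0, …, x, …, 0]`, and `Counts = [0, …, 1, …, 0]`. -/
noncomputable def openRound {n : ℕ} (i : Fin n) (ρ : Round) (xs : List ℝ) : RoundState n where
  ciphers := xs.mapIdx fun a x => Cipher.enc (Pi.single i x) (some i) (ρ.nonce + a)
  counts := Pi.single i 1
  decided := false

open Classical in
/-- Process `i` sends its current variables of round `ρ` to all its neighbours. -/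
noncomputable def broadcast {n : ℕ} (G : SimpleGraph (Fin n)) (i : Fin n) (ρ : Round)
    (rs : RoundState n) : Multiset (Packet n) :=
  (Finset.univ.filter fun j => G.Adj i j).val.map fun j =>
    ⟨some i, some j, ⟨.gossip ρ rs.counts, rs.ciphers, []⟩⟩

/-- The sum of `e` and its rotations by `1, …, k`. -/
def rotateSum {n : ℕ} (e : Cipher n) : ℕ → Cipher n
  | 0 => e
  | k + 1 => (rotateSum e k).add (e.rotate (k + 1))

/-- The Prepare phase: division of each slot by `n * Counts`, then summation over all slots by
rotations. -/
noncomputable def prepare {n : ℕ} (counts : Fin n → ℕ) (e : Cipher n) : Cipher n :=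
  rotateSum (e.mulPlain fun j => (counts j : ℝ)⁻¹ / n) (n - 1)

/-- Process `i` starts round `ρ` with initial values `xs`. -/
noncomputable def enterRound {n : ℕ} (G : SimpleGraph (Fin n)) (i : Fin n) (ρ : Round)
    (xs : List ℝ) (st : ProcState n) : ProcState n × Multiset (Packet n) :=
  ({ st with rounds := Function.update st.rounds ρ (some (openRound i ρ xs)) },
    broadcast G i ρ (openRound i ρ xs))

open Classical in
/-- Process `i` receives `Counts` and ciphertexts of round `ρ`. Messages that arrive after its
decision, or whose nonzero counts are nonzero locally as well, are ignored. Otherwise everything is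
added up and sent to the neighbours; and if no count is zero any more, the output of the
Prepare phase goes to the trusted process. -/
noncomputable def receiveGossip {n : ℕ} (G : SimpleGraph (Fin n)) (i : Fin n) (ρ : Round)
    (rs : RoundState n) (counts : Fin n → ℕ) (ciphers : List (Cipher n)) (st : ProcState n) :
    ProcState n × Multiset (Packet n) :=
  if rs.decided = true ∨ ∀ j, counts j ≠ 0 → rs.counts j ≠ 0 then (st, 0)
  else
    let rs' : RoundState n :=
      { ciphers := List.zipWith Cipher.add rs.ciphers ciphers
        counts := rs.counts + counts
        decided := decide (∀ j, (rs.counts + counts) j ≠ 0) }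
    ({ st with rounds := Function.update st.rounds ρ (some rs') },
      broadcast G i ρ rs' +
        if rs'.decided = true then
          {⟨some i, none, ⟨.prepared ρ, rs'.ciphers.map (prepare rs'.counts), []⟩⟩}
        else 0)

open Classical in
/-- Process `i`, with initial value `x`, is given the decrypted results of a round: it starts the
next round, or decides after the last one. Later announcements of the same results are ignored. -/
noncomputable def receiveResult {n : ℕ} (G : SimpleGraph (Fin n)) (c : ℝ) (x : ℝ) (i : Fin n)
    (ρ : Round) (plains : List (Vec n)) (st : ProcState n) : ProcState n × Multiset (Packet n) :=
  let y : ℝ := plains.getD 0 0 i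
  match ρ with
  | .avg =>
    if (st.rounds .dev).isSome then (st, 0)
    else enterRound G i .dev [(x - y) ^ 2] { st with mean := y }
  | .dev =>
    if (st.rounds .final).isSome then (st, 0)
    else enterRound G i .final (if c * √y < |x - st.mean| then [0, 0] else [x, 1]) st
  | .final =>
    if st.decision.isSome then (st, 0)
    else ({ st with decision := some (y / plains.getD 1 0 i) }, 0)

/-- The reaction of process `i` with initial value `x` to a message: its new state and the messages
it sends; `none` if it has to wait, because it has not started the round of the message or, for a
result, has not carried out the Prepare phase. -/
noncomputable def handle {n : ℕ} (G : SimpleGraph (Fin n)) (c : ℝ) (x : ℝ) (i : Fin n)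
    (st : ProcState n) (m : Msg n) : Option (ProcState n × Multiset (Packet n)) :=
  match m.header with
  | .gossip ρ counts =>
    (st.rounds ρ).map fun rs => receiveGossip G i ρ rs counts m.ciphers st
  | .prepared _ => some (st, 0)
  | .result ρ =>
    match st.rounds ρ with
    | none => none
    | some rs => if rs.decided = true then some (receiveResult G c x i ρ m.plains st) else none

/-- The trusted process decrypts the output of the Prepare phase and announces it to all. -/
noncomputable def handleTrusted {n : ℕ} (m : Msg n) : Multiset (Packet n) :=
  match m.header with
  | .prepared ρ =>
    Finset.univ.val.map fun k => ⟨none, some k, ⟨.result ρ, [], m.ciphers.map Cipher.dec⟩⟩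
  | _ => 0

/-- Append an event to the log of agent `a`. -/
def addEvent {n : ℕ} (log : Agent n → List (Event n)) (a : Agent n) (e : Event n) :
    Agent n → List (Event n) :=
  Function.update log a (log a ++ [e])

/-- The asynchronous steps of the system, when all processes follow the algorithm with parameter
`c` and initial values `v` on the communication graph `G`. -/
inductive Step {n : ℕ} (G : SimpleGraph (Fin n)) (c : ℝ) (v : Vec n) : State n → State n → Prop
  | start (s : State n) (i : Fin n) (h : (s.procs i).rounds .avg = none) :
      Step G c v s
        { procs := Function.update s.procs i (enterRound G i .avg [v i] (s.procs i)).1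
          net := s.net + (enterRound G i .avg [v i] (s.procs i)).2
          inbox := s.inbox
          log := addEvent s.log (some i) .start }
  | arrive (s : State n) (p : Packet n) (rest : Multiset (Packet n)) (h : s.net = p ::ₘ rest) :
      Step G c v s
        { procs := s.procs
          net := rest
          inbox := Function.update s.inbox p.dst (p ::ₘ s.inbox p.dst)
          log := addEvent s.log p.dst (.arrive p) }
  | consume (s : State n) (i : Fin n) (p : Packet n) (rest : Multiset (Packet n))
      (st : ProcState n) (out : Multiset (Packet n)) (h : s.inbox (some i) = p ::ₘ rest)
      (hst : handle G c (v i) i (s.procs i) p.msg = some (st, out)) :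
      Step G c v s
        { procs := Function.update s.procs i st
          net := s.net + out
          inbox := Function.update s.inbox (some i) rest
          log := addEvent s.log (some i) (.consume p) }
  | consumeTrusted (s : State n) (p : Packet n) (rest : Multiset (Packet n))
      (h : s.inbox none = p ::ₘ rest) :
      Step G c v s
        { procs := s.procs
          net := s.net + handleTrusted p.msg
          inbox := Function.update s.inbox none rest
          log := addEvent s.log none (.consume p) }

/-- `s` can be reached, at any time of any execution, from the initial values `v`. -/
def Reachable {n : ℕ} (G : SimpleGraph (Fin n)) (c : ℝ) (v : Vec n) (s : State n) : Prop :=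
  Relation.ReflTransGen (Step G c v) (State.initial n) s

/-! ### What an agent can learn -/

/-- The message of an event. -/
def Event.packet {n : ℕ} : Event n → Option (Packet n)
  | start => none
  | arrive p => some p
  | consume p => some p

/-- What is openly visible of an event: everything except the ciphertexts and decrypted results. -/
def Event.shape {n : ℕ} (e : Event n) :
    Fin 3 × Option (Agent n × Agent n × Header n × ℕ × ℕ) :=
  (match e with
    | start => 0
    | arrive _ => 1
    | consume _ => 2,
   e.packet.map fun p =>
    (p.src, p.dst, p.msg.header, p.msg.ciphers.length, p.msg.plains.length))

/-- The view of an agent: the visible course of events, all ciphertexts seen, and all plaintexts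
seen, the first of which is its own initial value. -/
structure View (n : ℕ) : Type where
  shape : List (Fin 3 × Option (Agent n × Agent n × Header n × ℕ × ℕ))
  ciphers : List (Cipher n)
  plains : List (Vec n)

/-- The view of agent `o` in the state `s`, when the initial values are `v`. -/
def view {n : ℕ} (o : Agent n) (v : Vec n) (s : State n) : View n where
  shape := (s.log o).map Event.shape
  ciphers := (s.log o).flatMap fun e => (e.packet.map fun p => p.msg.ciphers).getD []
  plains := (o.map fun i => (fun _ => v i : Vec n)).toList ++
    (s.log o).flatMap fun e => (e.packet.map fun p => p.msg.plains).getD []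

mutual

/-- Computations with a plaintext as output that an agent may carry out on its view. -/
inductive PlainRecipe (n : ℕ) : Type
  | const (x : Vec n)
  | seen (k : ℕ)
  | apply (f : Vec n → Vec n → Vec n) (p q : PlainRecipe n)
  | dec (e : CipherRecipe n)

/-- Computations with a ciphertext as output that an agent may carry out on its view. -/
inductive CipherRecipe (n : ℕ) : Type
  | seen (k : ℕ)
  | enc (p : PlainRecipe n) (r : ℕ)
  | add (e f : CipherRecipe n)
  | addPlain (e : CipherRecipe n) (p : PlainRecipe n)
  | mul (e f : CipherRecipe n)
  | mulPlain (e : CipherRecipe n) (p : PlainRecipe n)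
  | rotate (e : CipherRecipe n) (k : ℕ)

end

mutual

/-- Result of a computation by agent `o` on the view `V`. Only the trusted process holds the secret
key, so decryption gives nothing to the others. -/
def PlainRecipe.eval {n : ℕ} (o : Agent n) (V : View n) : PlainRecipe n → Vec n
  | .const x => x
  | .seen k => V.plains.getD k 0
  | .apply f p q => f (p.eval o V) (q.eval o V)
  | .dec e => if o = none then (e.eval o V).dec else 0

/-- Result of a computation by agent `o` on the view `V`. The random strings available to `o` are
its own, including those it used while following the algorithm. -/
def CipherRecipe.eval {n : ℕ} (o : Agent n) (V : View n) : CipherRecipe n → Cipher n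
  | .seen k => V.ciphers.getD k (.enc 0 o 0)
  | .enc p r => .enc (p.eval o V) o r
  | .add e f => .add (e.eval o V) (f.eval o V)
  | .addPlain e p => .addPlain (e.eval o V) (p.eval o V)
  | .mul e f => .mul (e.eval o V) (f.eval o V)
  | .mulPlain e p => .mulPlain (e.eval o V) (p.eval o V)
  | .rotate e k => .rotate (e.eval o V) k

end

/-- Agent `o` cannot tell the views `V` and `W` apart: the course of events looks the same, and no
comparison of two computed plaintexts or of two computed ciphertexts has different outcomes. -/
def Indistinguishable {n : ℕ} (o : Agent n) (V W : View n) : Prop :=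
  V.shape = W.shape ∧
  (∀ p q : PlainRecipe n, p.eval o V = q.eval o V ↔ p.eval o W = q.eval o W) ∧
  (∀ e f : CipherRecipe n,
    (e.eval o V).Same (f.eval o V) ↔ (e.eval o W).Same (f.eval o W))

/-- Agent `o` has learned, in the state `s` reached from the initial values `v`, that `P` holds of
the initial values: `P` is true in all executions that `o` cannot tell from the actual one. -/
def Learns {n : ℕ} (G : SimpleGraph (Fin n)) (c : ℝ) (o : Agent n) (v : Vec n) (s : State n)
    (P : Vec n → Prop) : Prop :=
  ∀ (w : Vec n) (t : State n), Reachable G c w t →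
    Indistinguishable o (view o v s) (view o w t) → P w

end OutlierConsensus

/-!
Any two vectors `v` and `w` with the same announced results have executions with the same schedule
that differ only in the encrypted plaintexts. Given an execution on `v`, replace the plaintext `x`
of each encryption `enc x a r` by `x + δ a r`, where `δ` (`inputShift`) is the difference between
what agent `a` encrypts with its random string `r` on `w` and on `v`. Since the control flow of the
algorithm depends only on the plaintext vectors *Counts* and on announced results, which agree, the
outcome is an execution on `w` (`Step.shift`, `Reachable.shift`). That the announced results are
indeed the averages of the inputs is an invariant of the algorithm (`Reachable.stateOk`): slot `j`
of each ciphertext is `Counts j` times the input of process `j`, so that the Prepare phase computes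
the average (`dec_prepare`).

An agent `o` with the same initial value in `v` and `w` cannot detect the replacement
(`Reachable.indistinguishable`). Its own encryptions are unchanged. The replacement is a bijection
on ciphertext expressions that respects all algebraic identities, so comparisons of ciphertexts keep
their outcomes (`Cipher.same_shift_iff`). The trusted process can decrypt, but all it receives are
outputs of the Prepare phase, whose decryptions are the announced results, and decryption is
a homomorphism for the operations it can apply.

Hence whatever `o` has learned holds for `w` (`Learns.of_sameResults`). The claims about outliers
follow since permuting the initial values permutes the outliers and preserves the results
(`sameResults_comp_perm`); for two processes, the permutation is their transposition.
-/

namespace OutlierConsensus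

variable {n : ℕ} {G : SimpleGraph (Fin n)} {c : ℝ} {v w : Vec n}

/-! ### Shifting plaintexts -/

/-- Replace the plaintext `x` of every encryption `enc x a r` in a ciphertext expression by
`x + δ a r`, keeping the random string. -/
def Cipher.shift (δ : Agent n → ℕ → Vec n) : Cipher n → Cipher n
  | enc x a r => enc (x + δ a r) a r
  | add e f => add (e.shift δ) (f.shift δ)
  | addPlain e x => addPlain (e.shift δ) x
  | mul e f => mul (e.shift δ) (f.shift δ)
  | mulPlain e x => mulPlain (e.shift δ) x
  | rotate e k => rotate (e.shift δ) k

theorem Cipher.Same.shift (δ : Agent n → ℕ → Vec n) {e f : Cipher n} (h : e.Same f) :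
    (e.shift δ).Same (f.shift δ) := by
  induction h with
  | refl => exact .refl _
  | symm _ ih => exact ih.symm
  | trans _ _ ih ih' => exact ih.trans ih'
  | add_congr _ _ ih ih' => exact .add_congr ih ih'
  | addPlain_congr x _ ih => exact .addPlain_congr x ih
  | mul_congr _ _ ih ih' => exact .mul_congr ih ih'
  | mulPlain_congr x _ ih => exact .mulPlain_congr x ih
  | rotate_congr k _ ih => exact .rotate_congr k ih
  | enc_addPlain x a r y =>
    have h := Cipher.Same.enc_addPlain (x + δ a r) a r y
    rwa [add_right_comm] at h
  | add_comm => exact .add_comm _ _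
  | add_assoc => exact .add_assoc _ _ _
  | mul_comm => exact .mul_comm _ _
  | mul_assoc => exact .mul_assoc _ _ _
  | mul_add => exact .mul_add _ _ _
  | add_addPlain => exact .add_addPlain _ _ _
  | addPlain_addPlain => exact .addPlain_addPlain _ _ _
  | addPlain_zero => exact .addPlain_zero _
  | mulPlain_add => exact .mulPlain_add _ _ _
  | mulPlain_addPlain => exact .mulPlain_addPlain _ _ _
  | mulPlain_mul => exact .mulPlain_mul _ _ _
  | mulPlain_mulPlain => exact .mulPlain_mulPlain _ _ _
  | mulPlain_plain_add => exact .mulPlain_plain_add _ _ _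
  | mulPlain_one => exact .mulPlain_one _
  | rotate_add => exact .rotate_add _ _ _
  | rotate_addPlain => exact .rotate_addPlain _ _ _
  | rotate_mul => exact .rotate_mul _ _ _
  | rotate_mulPlain => exact .rotate_mulPlain _ _ _
  | rotate_rotate => exact .rotate_rotate _ _ _
  | rotate_zero => exact .rotate_zero _

theorem Cipher.shift_neg_shift (δ : Agent n → ℕ → Vec n) (e : Cipher n) :
    (e.shift δ).shift (-δ) = e := by
  induction e <;> simp_all [Cipher.shift]

/-- The shift is invertible and respects the identities, so comparing ciphertexts does not reveal
it. -/
theorem Cipher.same_shift_iff (δ : Agent n → ℕ → Vec n) {e f : Cipher n} :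
    (e.shift δ).Same (f.shift δ) ↔ e.Same f := by
  refine ⟨fun h => ?_, fun h => h.shift δ⟩
  simpa only [Cipher.shift_neg_shift] using h.shift (-δ)

/-- Shift all ciphertexts of a message, leaving the plaintexts as they are. -/
def Msg.shift (δ : Agent n → ℕ → Vec n) (m : Msg n) : Msg n :=
  { m with ciphers := m.ciphers.map (Cipher.shift δ) }

/-- Shift all ciphertexts of a packet. -/
def Packet.shift (δ : Agent n → ℕ → Vec n) (p : Packet n) : Packet n :=
  { p with msg := p.msg.shift δ }

/-- Shift all ciphertexts among the variables of a round. -/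
def RoundState.shift (δ : Agent n → ℕ → Vec n) (rs : RoundState n) : RoundState n :=
  { rs with ciphers := rs.ciphers.map (Cipher.shift δ) }

/-- Shift all ciphertexts in the local state of a process. -/
def ProcState.shift (δ : Agent n → ℕ → Vec n) (st : ProcState n) : ProcState n :=
  { st with rounds := fun ρ => (st.rounds ρ).map (RoundState.shift δ) }

/-- Shift all ciphertexts of a witnessed event. -/
def Event.shift (δ : Agent n → ℕ → Vec n) : Event n → Event n
  | start => start
  | arrive p => arrive (p.shift δ)
  | consume p => consume (p.shift δ)

/-- Shift all ciphertexts in a global state. -/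
def State.shift (δ : Agent n → ℕ → Vec n) (s : State n) : State n where
  procs i := (s.procs i).shift δ
  net := s.net.map (Packet.shift δ)
  inbox a := (s.inbox a).map (Packet.shift δ)
  log a := (s.log a).map (Event.shift δ)

/-! ### The inputs of the rounds -/

open Classical in
/-- The vector whose entry `i` is encrypted by process `i` with its random string `r` when the
algorithm runs on `v`; the last round uses the two random strings 2 and 3. -/
noncomputable def nonceInput (c : ℝ) (v : Vec n) : ℕ → Vec n
  | 0 => v
  | 1 => fun i => (v i - mean v) ^ 2
  | 2 => fun i => if IsOutlier c v i then 0 else v i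
  | 3 => fun i => if IsOutlier c v i then 0 else 1
  | _ => 0

/-- The vectors that are averaged in round `ρ` when the algorithm runs on `v`. -/
noncomputable def inputs (c : ℝ) (v : Vec n) : Round → List (Vec n)
  | .avg => [nonceInput c v 0]
  | .dev => [nonceInput c v 1]
  | .final => [nonceInput c v 2, nonceInput c v 3]

/-- The plaintexts announced after round `ρ` when the algorithm runs on `v`: constant vectors
with the averages of the inputs. -/
noncomputable def results (c : ℝ) (v : Vec n) (ρ : Round) : List (Vec n) :=
  (inputs c v ρ).map fun u _ => mean u

theorem SameResults.results_eq (h : SameResults c v w) (ρ : Round) :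
    results c v ρ = results c w ρ := by
  obtain ⟨h1, h2, h3, h4⟩ := h
  cases ρ
  · simpa [results, inputs, nonceInput] using congrArg (fun y (_ : Fin n) => y) h1
  · simpa [results, inputs, nonceInput, variance] using congrArg (fun y (_ : Fin n) => y) h2
  · simpa [results, inputs, nonceInput, keptMean, keptFraction] using
      And.intro (congrArg (fun y (_ : Fin n) => y) h3) (congrArg (fun y (_ : Fin n) => y) h4)

theorem SameResults.nonceInput_eq (h : SameResults c v w) {i : Fin n} (hi : w i = v i) (r : ℕ) :
    nonceInput c w r i = nonceInput c v r i := by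
  have hout : IsOutlier c w i ↔ IsOutlier c v i := by
    simp only [IsOutlier, stdDev, h.1, h.2.1, hi]
  match r with
  | 0 => exact hi
  | 1 => simp [nonceInput, hi, h.1]
  | 2 => by_cases h : IsOutlier c v i <;> simp [nonceInput, hout.2, mt hout.1, h, hi]
  | 3 => by_cases h : IsOutlier c v i <;> simp [nonceInput, hout.2, mt hout.1, h]
  | r + 4 => rfl

/-- The shift that turns the encryptions made on the initial values `v` into those made
on `w`. -/
noncomputable def inputShift (c : ℝ) (v w : Vec n) : Agent n → ℕ → Vec n
  | none, _ => 0
  | some i, r => Pi.single i (nonceInput c w r i - nonceInput c v r i)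

theorem SameResults.inputShift_eq_zero (h : SameResults c v w) {o : Agent n}
    (ho : ∀ i, o = some i → w i = v i) (r : ℕ) : inputShift c v w o r = 0 := by
  cases o with
  | none => rfl
  | some i => simp [inputShift, h.nonceInput_eq (ho i rfl)]

/-- The shift turns the first ciphertexts of a round on `v` into those of the round on `w`. -/
theorem openRound_shift (i : Fin n) (ρ : Round) :
    (openRound i ρ ((inputs c v ρ).map (· i))).shift (inputShift c v w) =
      openRound i ρ ((inputs c w ρ).map (· i)) := by
  cases ρ <;>
    simp [openRound, RoundState.shift, inputs, Cipher.shift, inputShift, Round.nonce,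
      ← Pi.single_add]

/-! ### The Prepare phase -/

theorem dec_rotateSum (e : Cipher n) (k : ℕ) :
    (rotateSum e k).dec = ∑ l ∈ Finset.range (k + 1), rotVec l e.dec := by
  induction k with
  | zero =>
    funext j
    simp [rotateSum, rotVec, Nat.mod_eq_of_lt j.isLt]
  | succ k ih => rw [Finset.sum_range_succ, ← ih]; rfl

/-- At each slot, the rotations of `x` by `0, …, n - 1` add up to the sum of all entries. -/
theorem sum_rotVec (x : Vec n) (j : Fin n) :
    ∑ l ∈ Finset.range n, rotVec l x j = ∑ i, x i := by
  have : NeZero n := ⟨j.pos.ne'⟩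
  rw [Finset.sum_range, ← Equiv.sum_comp (Equiv.addLeft j) x]
  exact Finset.sum_congr rfl fun l _ => congrArg x (Fin.ext (Fin.val_add j l).symm)

/-- Dividing by the counts restores the inputs, so that the Prepare phase computes the average. -/
theorem dec_prepare {counts : Fin n → ℕ} (hc : ∀ j, counts j ≠ 0) {e : Cipher n} {u : Vec n}
    (he : e.dec = fun j => counts j * u j) : (prepare counts e).dec = fun _ => mean u := by
  funext j
  have hn : n - 1 + 1 = n := Nat.sub_add_cancel j.pos
  rw [prepare, dec_rotateSum, hn, Finset.sum_apply, sum_rotVec, mean, Finset.sum_div]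
  refine Finset.sum_congr rfl fun i _ => ?_
  have : (counts i : ℝ) ≠ 0 := Nat.cast_ne_zero.2 (hc i)
  simp only [Cipher.dec, he, Pi.mul_apply]
  field_simp

theorem prepare_shift (δ : Agent n → ℕ → Vec n) (counts : Fin n → ℕ) (e : Cipher n) :
    (prepare counts e).shift δ = prepare counts (e.shift δ) := by
  have key : ∀ (f : Cipher n) (k : ℕ), (rotateSum f k).shift δ = rotateSum (f.shift δ) k := by
    intro f k
    induction k with
    | zero => rfl
    | succ k ih => simp [rotateSum, Cipher.shift, ih]
  simp [prepare, key, Cipher.shift]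

/-! ### Correctness of the algorithm -/

/-- The ciphertexts `cs` hold the inputs of round `ρ`, slot `j` multiplied by `counts j`. -/
def Holds (c : ℝ) (v : Vec n) (ρ : Round) (counts : Fin n → ℕ) (cs : List (Cipher n)) : Prop :=
  cs.map Cipher.dec = (inputs c v ρ).map fun u j => (counts j : ℝ) * u j

/-- The contents of a message are correct for the initial values `v`. -/
def MsgOk (c : ℝ) (v : Vec n) (m : Msg n) : Prop :=
  match m.header with
  | .gossip ρ counts => Holds c v ρ counts m.ciphers
  | .prepared ρ => m.ciphers.map Cipher.dec = results c v ρ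
  | .result ρ => m.plains = results c v ρ

/-- A packet is correct: so is its message, and the trusted process is sent only outputs of the
Prepare phase. -/
def PacketOk (c : ℝ) (v : Vec n) (p : Packet n) : Prop :=
  MsgOk c v p.msg ∧ (p.dst = none → ∃ ρ, p.msg.header = .prepared ρ)

/-- The local state of a process is correct for the initial values `v`. The announced mean is
stored when the process enters the second round; before, it is the default value. -/
def ProcOk (c : ℝ) (v : Vec n) (st : ProcState n) : Prop :=
  (∀ ρ rs, st.rounds ρ = some rs → Holds c v ρ rs.counts rs.ciphers) ∧
    ((st.rounds .dev).isSome → st.mean = mean v)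

/-- The correctness invariant of the algorithm on the initial values `v`. -/
structure StateOk (c : ℝ) (v : Vec n) (s : State n) : Prop where
  procs : ∀ i, ProcOk c v (s.procs i)
  net : ∀ p ∈ s.net, PacketOk c v p
  inbox : ∀ a, ∀ p ∈ s.inbox a, PacketOk c v p ∧ p.dst = a
  log : ∀ a, ∀ e ∈ s.log a, ∀ p, e.packet = some p → PacketOk c v p ∧ p.dst = a

theorem holds_openRound (i : Fin n) (ρ : Round) :
    Holds c v ρ (openRound i ρ ((inputs c v ρ).map (· i))).counts
      (openRound i ρ ((inputs c v ρ).map (· i))).ciphers := by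
  have key : ∀ u : Vec n,
      (Pi.single i (u i) : Vec n) = fun j => (((Pi.single i 1 : Fin n → ℕ) j : ℕ) : ℝ) * u j := by
    intro u
    funext j
    by_cases h : j = i
    · subst h; simp
    · simp [h]
  cases ρ <;> simp [Holds, openRound, inputs, Cipher.dec, ← key]

theorem Holds.add {ρ : Round} {k l : Fin n → ℕ} {cs ds : List (Cipher n)}
    (hc : Holds c v ρ k cs) (hd : Holds c v ρ l ds) :
    Holds c v ρ (k + l) (List.zipWith Cipher.add cs ds) := by
  unfold Holds at *
  generalize inputs c v ρ = us at *
  induction us generalizing cs ds with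
  | nil => simp_all
  | cons u us ih =>
    obtain ⟨e, cs, rfl, he, hcs⟩ := List.map_eq_cons_iff.1 hc
    obtain ⟨f, ds, rfl, hf, hds⟩ := List.map_eq_cons_iff.1 hd
    simp only [List.zipWith_cons_cons, List.map_cons, ih hcs hds, Cipher.dec, he, hf]
    congr 1
    funext j
    simp [add_mul]

theorem Holds.prepare {ρ : Round} {k : Fin n → ℕ} {cs : List (Cipher n)}
    (h : Holds c v ρ k cs) (hk : ∀ j, k j ≠ 0) :
    (cs.map (prepare k)).map Cipher.dec = results c v ρ := by
  unfold Holds at h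
  unfold results
  generalize inputs c v ρ = us at *
  induction us generalizing cs with
  | nil => simp [List.map_eq_nil_iff.1 h]
  | cons u us ih =>
    obtain ⟨e, cs, rfl, he, hcs⟩ := List.map_eq_cons_iff.1 h
    simp only [List.map_cons, ih hcs, dec_prepare hk he]

theorem packetOk_of_mem_broadcast {i : Fin n} {ρ : Round} {rs : RoundState n}
    (h : Holds c v ρ rs.counts rs.ciphers) {p : Packet n} (hp : p ∈ broadcast G i ρ rs) :
    PacketOk c v p := by
  obtain ⟨j, -, rfl⟩ := Multiset.mem_map.1 hp
  exact ⟨h, by simp⟩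

theorem packetOk_of_mem_handleTrusted {m : Msg n} (h : MsgOk c v m) {p : Packet n}
    (hp : p ∈ handleTrusted m) : PacketOk c v p := by
  unfold handleTrusted at hp
  unfold MsgOk at h
  split at hp
  next hm =>
    rw [hm] at h
    obtain ⟨j, -, rfl⟩ := Multiset.mem_map.1 hp
    exact ⟨h, by simp⟩
  next => simp at hp

theorem ProcOk.update {st : ProcState n} (h : ProcOk c v st) {ρ : Round} {rs : RoundState n}
    (hrs : Holds c v ρ rs.counts rs.ciphers) {y : ℝ}
    (hy : (Function.update st.rounds ρ (some rs) .dev).isSome → y = mean v) :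
    ProcOk c v { st with rounds := Function.update st.rounds ρ (some rs), mean := y } := by
  refine ⟨fun ρ' rs' h' => ?_, hy⟩
  by_cases hρ : ρ' = ρ
  · subst hρ
    simp only [Function.update_self, Option.some.injEq] at h'
    exact h' ▸ hrs
  · exact h.1 _ _ ((Function.update_of_ne hρ _ _).symm.trans h')

theorem receiveGossip_ok {i : Fin n} {ρ : Round} {rs : RoundState n} {counts : Fin n → ℕ}
    {cs : List (Cipher n)} {st : ProcState n} (hst : ProcOk c v st) (hρ : st.rounds ρ = some rs)
    (h : Holds c v ρ counts cs) :
    ProcOk c v (receiveGossip G i ρ rs counts cs st).1 ∧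
      ∀ p ∈ (receiveGossip G i ρ rs counts cs st).2, PacketOk c v p := by
  have hadd := (hst.1 ρ rs hρ).add h
  unfold receiveGossip
  split_ifs with h1
  · exact ⟨hst, by simp⟩
  · refine ⟨hst.update hadd fun hdev => hst.2 ?_, fun p hp => ?_⟩
    · by_cases hd : Round.dev = ρ
      · rw [hd, hρ]; rfl
      · rwa [Function.update_of_ne hd] at hdev
    · rcases Multiset.mem_add.1 hp with hp | hp
      · exact packetOk_of_mem_broadcast (by exact hadd) hp
      · split_ifs at hp with h2
        · rw [Multiset.mem_singleton.1 hp]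
          exact ⟨hadd.prepare (by simpa using h2), fun _ => ⟨ρ, rfl⟩⟩
        · simp at hp

theorem inputs_dev (i : Fin n) : (inputs c v .dev).map (· i) = [(v i - mean v) ^ 2] := rfl

open Classical in
theorem inputs_final (i : Fin n) : (inputs c v .final).map (· i) =
    if c * √(variance v) < |v i - mean v| then [0, 0] else [v i, 1] := by
  by_cases h : IsOutlier c v i
  · have h' : c * √(variance v) < |v i - mean v| := h
    simp [inputs, nonceInput, h, h']
  · have h' : ¬ c * √(variance v) < |v i - mean v| := h
    simp [inputs, nonceInput, h, if_neg h']

theorem receiveResult_ok {i : Fin n} {ρ : Round} {st : ProcState n} (hst : ProcOk c v st)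
    (hρ : (st.rounds ρ).isSome) :
    ProcOk c v (receiveResult G c (v i) i ρ (results c v ρ) st).1 ∧
      ∀ p ∈ (receiveResult G c (v i) i ρ (results c v ρ) st).2, PacketOk c v p := by
  cases ρ
  · simp only [receiveResult]
    split_ifs with h
    · exact ⟨hst, by simp⟩
    · have hy : (results c v .avg).getD 0 0 i = mean v := rfl
      rw [hy, ← inputs_dev (c := c)]
      exact ⟨hst.update (holds_openRound i .dev) fun _ => rfl,
        fun p hp => packetOk_of_mem_broadcast (holds_openRound i .dev) hp⟩
  · simp only [receiveResult]
    by_cases h : (st.rounds .final).isSome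
    · rw [if_pos h]
      exact ⟨hst, by simp⟩
    · rw [if_neg h]
      have hy : (results c v .dev).getD 0 0 i = variance v := rfl
      have hx := inputs_final (c := c) (v := v) i
      rw [hy, hst.2 hρ, ← hx]
      exact ⟨hst.update (holds_openRound i .final) fun _ => hst.2 hρ,
        fun p hp => packetOk_of_mem_broadcast (holds_openRound i .final) hp⟩
  · simp only [receiveResult]
    split_ifs with h
    · exact ⟨hst, by simp⟩
    · exact ⟨hst, by simp⟩

theorem handle_ok {i : Fin n} {st st' : ProcState n} {m : Msg n} {out : Multiset (Packet n)}
    (hst : ProcOk c v st) (hm : MsgOk c v m)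
    (h : handle G c (v i) i st m = some (st', out)) :
    ProcOk c v st' ∧ ∀ p ∈ out, PacketOk c v p := by
  unfold handle at h
  unfold MsgOk at hm
  split at h
  next ρ counts hh =>
    rw [hh] at hm
    obtain ⟨rs, hρ, h⟩ := Option.map_eq_some_iff.1 h
    simpa only [h] using receiveGossip_ok (G := G) (i := i) hst hρ hm
  next =>
    cases h
    exact ⟨hst, by simp⟩
  next ρ hh =>
    rw [hh] at hm
    change m.plains = _ at hm
    split at h
    next => cases h
    next rs hρ =>
      split_ifs at h
      have key := receiveResult_ok (G := G) (i := i) hst (ρ := ρ) (by rw [hρ]; rfl)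
      rw [Option.some.injEq] at h
      rwa [← hm, h] at key

theorem stateOk_initial : StateOk c v (State.initial n) where
  procs _ := ⟨by simp [State.initial], by simp [State.initial]⟩
  net := by simp [State.initial]
  inbox := by simp [State.initial]
  log := by simp [State.initial]

theorem StateOk.log_addEvent {s : State n} (hs : StateOk c v s) {a : Agent n} {e : Event n}
    (he : ∀ p, e.packet = some p → PacketOk c v p ∧ p.dst = a) (b : Agent n) :
    ∀ f ∈ addEvent s.log a e b, ∀ p, f.packet = some p → PacketOk c v p ∧ p.dst = b := by
  intro f hf
  unfold addEvent at hf
  by_cases hb : b = a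
  · subst hb
    rw [Function.update_self, List.mem_append, List.mem_singleton] at hf
    rcases hf with hf | rfl
    · exact hs.log b f hf
    · exact he
  · rw [Function.update_of_ne hb] at hf
    exact hs.log b f hf

theorem StateOk.inbox_update {s : State n} (hs : StateOk c v s) {a : Agent n}
    {M : Multiset (Packet n)} (hM : ∀ p ∈ M, PacketOk c v p ∧ p.dst = a) (b : Agent n) :
    ∀ p ∈ Function.update s.inbox a M b, PacketOk c v p ∧ p.dst = b := by
  by_cases hb : b = a
  · subst hb
    rwa [Function.update_self]
  · rw [Function.update_of_ne hb]
    exact hs.inbox b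

theorem StateOk.procs_update {s : State n} (hs : StateOk c v s) {i : Fin n} {st : ProcState n}
    (hst : ProcOk c v st) (j : Fin n) : ProcOk c v (Function.update s.procs i st j) := by
  by_cases hj : j = i
  · subst hj
    rwa [Function.update_self]
  · rw [Function.update_of_ne hj]
    exact hs.procs j

theorem inputs_avg (i : Fin n) : (inputs c v .avg).map (· i) = [v i] := rfl

theorem Step.stateOk {s t : State n} (h : Step G c v s t) (hs : StateOk c v s) :
    StateOk c v t := by
  cases h with
  | start i h =>
    rw [← inputs_avg (c := c)]
    refine ⟨hs.procs_update ((hs.procs i).update (holds_openRound i .avg) (hs.procs i).2),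
      fun p hp => ?_, hs.inbox, hs.log_addEvent (by simp [Event.packet])⟩
    rcases Multiset.mem_add.1 hp with hp | hp
    · exact hs.net p hp
    · exact packetOk_of_mem_broadcast (holds_openRound i .avg) hp
  | arrive p rest h =>
    have hp := hs.net p (by simp [h])
    refine ⟨hs.procs, fun q hq => hs.net q (by simp [h, show q ∈ rest from hq]),
      hs.inbox_update fun q hq => ?_, hs.log_addEvent fun q hq => ?_⟩
    · rcases Multiset.mem_cons.1 hq with rfl | hq
      · exact ⟨hp, rfl⟩
      · exact hs.inbox _ q hq
    · cases hq
      exact ⟨hp, rfl⟩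
  | consume i p rest st out h hst =>
    have hp := hs.inbox (some i) p (by simp [h])
    have hok := handle_ok (hs.procs i) hp.1.1 hst
    refine ⟨hs.procs_update hok.1, fun q hq => ?_,
      hs.inbox_update fun q hq => hs.inbox _ q (by simp [h, hq]), hs.log_addEvent fun q hq => ?_⟩
    · exact (Multiset.mem_add.1 hq).elim (hs.net q) (hok.2 q)
    · cases hq
      exact hp
  | consumeTrusted p rest h =>
    have hp := hs.inbox none p (by simp [h])
    refine ⟨hs.procs, fun q hq => ?_,
      hs.inbox_update fun q hq => hs.inbox _ q (by simp [h, hq]), hs.log_addEvent fun q hq => ?_⟩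
    · exact (Multiset.mem_add.1 hq).elim (hs.net q) (packetOk_of_mem_handleTrusted hp.1.1)
    · cases hq
      exact hp

theorem Reachable.stateOk {s : State n} (h : Reachable G c v s) : StateOk c v s := by
  induction h with
  | refl => exact stateOk_initial
  | tail _ h ih => exact h.stateOk ih

/-! ### Simulating an execution on other initial values -/

theorem broadcast_shift (δ : Agent n → ℕ → Vec n) (i : Fin n) (ρ : Round) (rs : RoundState n) :
    broadcast G i ρ (rs.shift δ) = (broadcast G i ρ rs).map (Packet.shift δ) := by
  simp only [broadcast, Multiset.map_map]
  rfl

theorem rounds_update_shift (δ : Agent n → ℕ → Vec n) (f : Round → Option (RoundState n))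
    (ρ : Round) (rs : RoundState n) :
    Function.update (fun ρ => (f ρ).map (RoundState.shift δ)) ρ (some (rs.shift δ)) =
      fun ρ' => (Function.update f ρ (some rs) ρ').map (RoundState.shift δ) := by
  funext ρ'
  by_cases h : ρ' = ρ
  · subst h; simp
  · simp [h]

theorem zipWith_add_shift (δ : Agent n → ℕ → Vec n) (cs ds : List (Cipher n)) :
    List.zipWith Cipher.add (cs.map (Cipher.shift δ)) (ds.map (Cipher.shift δ)) =
      (List.zipWith Cipher.add cs ds).map (Cipher.shift δ) := by
  rw [List.zipWith_map, List.map_zipWith]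
  rfl

theorem enterRound_shift (i : Fin n) (ρ : Round) (st : ProcState n) :
    enterRound G i ρ ((inputs c w ρ).map (· i)) (st.shift (inputShift c v w)) =
      Prod.map (ProcState.shift (inputShift c v w)) (Multiset.map (Packet.shift (inputShift c v w)))
        (enterRound G i ρ ((inputs c v ρ).map (· i)) st) := by
  simp only [enterRound, Prod.map, ← broadcast_shift, openRound_shift]
  simp only [ProcState.shift, ← rounds_update_shift, openRound_shift]

theorem receiveGossip_shift (δ : Agent n → ℕ → Vec n) (i : Fin n) (ρ : Round)
    (rs : RoundState n) (counts : Fin n → ℕ) (cs : List (Cipher n)) (st : ProcState n) :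
    receiveGossip G i ρ (rs.shift δ) counts (cs.map (Cipher.shift δ)) (st.shift δ) =
      Prod.map (ProcState.shift δ) (Multiset.map (Packet.shift δ))
        (receiveGossip G i ρ rs counts cs st) := by
  have hd : (rs.shift δ).decided = rs.decided := rfl
  have hc : (rs.shift δ).counts = rs.counts := rfl
  have hs : (rs.shift δ).ciphers = rs.ciphers.map (Cipher.shift δ) := rfl
  unfold receiveGossip
  simp only [hd, hc, hs, zipWith_add_shift]
  split_ifs with h1 h2
  · rfl
  all_goals
    simp only [Prod.map, Multiset.map_add, ← broadcast_shift, Multiset.map_singleton,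
      Multiset.map_zero]
    simp only [ProcState.shift, ← rounds_update_shift, RoundState.shift, Packet.shift, Msg.shift,
      List.map_map]
  congr 6
  funext e
  exact (prepare_shift δ _ e).symm

theorem isSome_rounds_shift (δ : Agent n → ℕ → Vec n) (st : ProcState n) (ρ : Round) :
    ((st.shift δ).rounds ρ).isSome = (st.rounds ρ).isSome :=
  Option.isSome_map

theorem receiveResult_shift (h : SameResults c v w) {i : Fin n} {ρ : Round} {st : ProcState n}
    (hst : ProcOk c v st) (hρ : (st.rounds ρ).isSome) :
    receiveResult G c (w i) i ρ (results c v ρ) (st.shift (inputShift c v w)) =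
      Prod.map (ProcState.shift (inputShift c v w)) (Multiset.map (Packet.shift (inputShift c v w)))
        (receiveResult G c (v i) i ρ (results c v ρ) st) := by
  cases ρ
  · simp only [receiveResult, isSome_rounds_shift]
    split_ifs
    · rfl
    · have hy : (results c v .avg).getD 0 0 i = mean v := rfl
      have hx := inputs_dev (c := c) (v := v) i
      have hx' := inputs_dev (c := c) (v := w) i
      rw [← h.1] at hx'
      rw [hy, ← hx, ← hx', ← enterRound_shift]
      rfl
  · simp only [receiveResult, isSome_rounds_shift]
    by_cases hf : (st.rounds .final).isSome
    · rw [if_pos hf, if_pos hf]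
      rfl
    · rw [if_neg hf, if_neg hf]
      have hy : (results c v .dev).getD 0 0 i = variance v := rfl
      have hx := inputs_final (c := c) (v := v) i
      have hx' := inputs_final (c := c) (v := w) i
      rw [← h.1, ← h.2.1] at hx'
      have hmean : (st.shift (inputShift c v w)).mean = st.mean := rfl
      rw [hy, hmean, hst.2 hρ, ← hx, ← hx', ← enterRound_shift]
  · simp only [receiveResult]
    have hd : (st.shift (inputShift c v w)).decision = st.decision := rfl
    rw [hd]
    split_ifs <;> rfl

theorem handle_shift (h : SameResults c v w) {i : Fin n} {st : ProcState n} {m : Msg n}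
    (hst : ProcOk c v st) (hm : MsgOk c v m) :
    handle G c (w i) i (st.shift (inputShift c v w)) (m.shift (inputShift c v w)) =
      (handle G c (v i) i st m).map (Prod.map (ProcState.shift (inputShift c v w))
        (Multiset.map (Packet.shift (inputShift c v w)))) := by
  obtain ⟨header, cs, ps⟩ := m
  cases header with
  | gossip ρ counts =>
    simp only [handle, Msg.shift, Option.map_map]
    rw [show (st.shift (inputShift c v w)).rounds ρ = (st.rounds ρ).map _ from rfl,
      Option.map_map]
    exact congrArg (Option.map · _) (funext fun rs => receiveGossip_shift _ i ρ rs counts cs st)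
  | prepared ρ => rfl
  | result ρ =>
    change ps = results c v ρ at hm
    subst hm
    simp only [handle, Msg.shift]
    rw [show (st.shift (inputShift c v w)).rounds ρ = (st.rounds ρ).map _ from rfl]
    rcases hρ : st.rounds ρ with _ | rs
    · rfl
    · have hd : (rs.shift (inputShift c v w)).decided = rs.decided := rfl
      simp only [Option.map_some, hd]
      split_ifs
      · rw [receiveResult_shift h hst (by rw [hρ]; rfl)]
        rfl
      · rfl

/-- The trusted process decrypts the same results from a prepared message and from its shift, if
they are correct for initial values with the same results. -/
theorem dec_shift_of_prepared (h : SameResults c v w) {δ : Agent n → ℕ → Vec n} {m : Msg n}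
    (hm : MsgOk c v m) (hm' : MsgOk c w (m.shift δ)) {ρ : Round} (hρ : m.header = .prepared ρ) :
    (m.shift δ).ciphers.map Cipher.dec = m.ciphers.map Cipher.dec := by
  obtain ⟨header, cs, ps⟩ := m
  subst hρ
  exact (Eq.trans hm' (h.results_eq ρ).symm).trans (Eq.symm hm)

theorem handleTrusted_shift {δ : Agent n → ℕ → Vec n} {m : Msg n}
    (hm : ∀ ρ, m.header = .prepared ρ →
      (m.shift δ).ciphers.map Cipher.dec = m.ciphers.map Cipher.dec) :
    handleTrusted (m.shift δ) = (handleTrusted m).map (Packet.shift δ) := by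
  obtain ⟨header, cs, ps⟩ := m
  cases header with
  | gossip => rfl
  | result => rfl
  | prepared ρ =>
    have := hm ρ rfl
    simp only [handleTrusted, Multiset.map_map, Msg.shift] at this ⊢
    rw [this]
    rfl

theorem map_update {α β γ : Type*} [DecidableEq α] (f : β → γ) (g : α → β) (a : α) (b : β) :
    (fun x => f (Function.update g a b x)) = Function.update (fun x => f (g x)) a (f b) :=
  Function.comp_update f g a b

theorem addEvent_shift (δ : Agent n → ℕ → Vec n) (log : Agent n → List (Event n)) (a : Agent n)
    (e : Event n) :
    (fun b => (addEvent log a e b).map (Event.shift δ)) =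
      addEvent (fun b => (log b).map (Event.shift δ)) a (e.shift δ) := by
  simp only [addEvent, map_update (List.map _), List.map_append, List.map_cons, List.map_nil]

/-- The shift commutes with the steps of the system. Correctness on both sides ensures that the
processes act on the same announced results. -/
theorem Step.shift (h : SameResults c v w) {s t : State n} (hst : Step G c v s t)
    (hs : StateOk c v s) (hs' : StateOk c w (s.shift (inputShift c v w))) :
    Step G c w (s.shift (inputShift c v w)) (t.shift (inputShift c v w)) := by
  cases hst with
  | start i hi =>
    have key := Step.start (G := G) (c := c) (v := w) (s.shift (inputShift c v w)) i
      (by simp [State.shift, ProcState.shift, hi])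
    have hrw := enterRound_shift (G := G) (c := c) (v := v) (w := w) i .avg (s.procs i)
    simp only [inputs_avg] at hrw
    convert key using 1
    simp only [State.shift, addEvent_shift, map_update (ProcState.shift _), Multiset.map_add, hrw]
    rfl
  | arrive p rest hp =>
    have key := Step.arrive (G := G) (c := c) (v := w) (s.shift (inputShift c v w))
      (p.shift (inputShift c v w)) (rest.map (Packet.shift (inputShift c v w)))
      (by simp [State.shift, hp])
    convert key using 1
    simp only [State.shift, addEvent_shift, map_update (Multiset.map _), Multiset.map_cons]
    rfl
  | consume i p rest st out hp hst =>
    have hok := hs.inbox (some i) p (by simp [hp])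
    have hh := handle_shift (G := G) (i := i) h (hs.procs i) hok.1.1
    rw [hst] at hh
    have key := Step.consume (G := G) (c := c) (v := w) (s.shift (inputShift c v w)) i
      (p.shift (inputShift c v w)) (rest.map (Packet.shift (inputShift c v w))) _ _
      (by simp [State.shift, hp]) hh
    convert key using 1
    simp only [State.shift, addEvent_shift, map_update (Multiset.map _),
      map_update (ProcState.shift _), Multiset.map_add]
    rfl
  | consumeTrusted p rest hp =>
    have hok := hs.inbox none p (by simp [hp])
    have hok' := hs'.inbox none (p.shift (inputShift c v w))
      (Multiset.mem_map_of_mem _ (by simp [hp]))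
    have key := Step.consumeTrusted (G := G) (c := c) (v := w) (s.shift (inputShift c v w))
      (p.shift (inputShift c v w)) (rest.map (Packet.shift (inputShift c v w)))
      (by simp [State.shift, hp])
    convert key using 1
    simp only [State.shift, addEvent_shift, map_update (Multiset.map _), Multiset.map_add]
    rw [show (p.shift (inputShift c v w)).msg = p.msg.shift _ from rfl,
      handleTrusted_shift fun ρ hρ => dec_shift_of_prepared h hok.1.1 hok'.1.1 hρ]
    rfl

/-- Every execution on `v` is turned by the shift into an execution on `w` with the same
schedule. -/
theorem Reachable.shift (h : SameResults c v w) {s : State n} (hs : Reachable G c v s) :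
    Reachable G c w (s.shift (inputShift c v w)) := by
  induction hs with
  | refl => exact .refl
  | tail hs hst ih => exact .tail ih (hst.shift h (Reachable.stateOk hs) (Reachable.stateOk ih))

/-! ### Indistinguishability -/

mutual

/-- The computations of `o` give the same plaintexts after a shift. -/
theorem PlainRecipe.eval_shift {δ : Agent n → ℕ → Vec n} {o : Agent n} {V W : View n}
    (hδ : ∀ r, δ o r = 0) (hp : W.plains = V.plains)
    (hc : W.ciphers = V.ciphers.map (Cipher.shift δ))
    (hdec : o = none → ∀ e ∈ V.ciphers, (e.shift δ).dec = e.dec) :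
    (p : PlainRecipe n) → p.eval o W = p.eval o V
  | .const x => rfl
  | .seen k => by simp only [PlainRecipe.eval, hp]
  | .apply f p q => by
    simp only [PlainRecipe.eval, PlainRecipe.eval_shift hδ hp hc hdec p,
      PlainRecipe.eval_shift hδ hp hc hdec q]
  | .dec e => by
    obtain ⟨h1, h2⟩ := CipherRecipe.eval_shift hδ hp hc hdec e
    simp only [PlainRecipe.eval]
    split_ifs with ho
    · rw [h1, h2 ho]
    · rfl

/-- The ciphertexts computed by `o` are shifted along with those in its view. If `o` holds the
secret key, they keep their decryptions, since decryption is compositional. -/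
theorem CipherRecipe.eval_shift {δ : Agent n → ℕ → Vec n} {o : Agent n} {V W : View n}
    (hδ : ∀ r, δ o r = 0) (hp : W.plains = V.plains)
    (hc : W.ciphers = V.ciphers.map (Cipher.shift δ))
    (hdec : o = none → ∀ e ∈ V.ciphers, (e.shift δ).dec = e.dec) :
    (e : CipherRecipe n) → e.eval o W = (e.eval o V).shift δ ∧
      (o = none → ((e.eval o V).shift δ).dec = (e.eval o V).dec)
  | .seen k => by
    simp only [CipherRecipe.eval, hc]
    by_cases hk : k < V.ciphers.length
    · simpa [List.getD, hk] using fun ho => hdec ho _ (List.getElem_mem hk)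
    · simp [List.getD, hk, Cipher.shift, hδ]
  | .enc p r => by
    simp [CipherRecipe.eval, Cipher.shift, hδ, PlainRecipe.eval_shift hδ hp hc hdec p]
  | .add e f => by
    obtain ⟨h1, h2⟩ := CipherRecipe.eval_shift hδ hp hc hdec e
    obtain ⟨h3, h4⟩ := CipherRecipe.eval_shift hδ hp hc hdec f
    exact ⟨by simp only [CipherRecipe.eval, h1, h3, Cipher.shift],
      fun ho => by simp only [CipherRecipe.eval, Cipher.shift, Cipher.dec, h2 ho, h4 ho]⟩
  | .addPlain e p => by
    obtain ⟨h1, h2⟩ := CipherRecipe.eval_shift hδ hp hc hdec e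
    have h3 := PlainRecipe.eval_shift hδ hp hc hdec p
    exact ⟨by simp only [CipherRecipe.eval, h1, h3, Cipher.shift],
      fun ho => by simp only [CipherRecipe.eval, Cipher.shift, Cipher.dec, h2 ho]⟩
  | .mul e f => by
    obtain ⟨h1, h2⟩ := CipherRecipe.eval_shift hδ hp hc hdec e
    obtain ⟨h3, h4⟩ := CipherRecipe.eval_shift hδ hp hc hdec f
    exact ⟨by simp only [CipherRecipe.eval, h1, h3, Cipher.shift],
      fun ho => by simp only [CipherRecipe.eval, Cipher.shift, Cipher.dec, h2 ho, h4 ho]⟩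
  | .mulPlain e p => by
    obtain ⟨h1, h2⟩ := CipherRecipe.eval_shift hδ hp hc hdec e
    have h3 := PlainRecipe.eval_shift hδ hp hc hdec p
    exact ⟨by simp only [CipherRecipe.eval, h1, h3, Cipher.shift],
      fun ho => by simp only [CipherRecipe.eval, Cipher.shift, Cipher.dec, h2 ho]⟩
  | .rotate e k => by
    obtain ⟨h1, h2⟩ := CipherRecipe.eval_shift hδ hp hc hdec e
    exact ⟨by simp only [CipherRecipe.eval, h1, Cipher.shift],
      fun ho => by simp only [CipherRecipe.eval, Cipher.shift, Cipher.dec, h2 ho]⟩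

end

/-- Agent `o` cannot detect a shift that leaves its own encryptions alone, provided that it either
cannot decrypt or sees the same decryptions before and after. -/
theorem indistinguishable_of_shift {δ : Agent n → ℕ → Vec n} {o : Agent n} {V W : View n}
    (hs : W.shape = V.shape) (hδ : ∀ r, δ o r = 0) (hp : W.plains = V.plains)
    (hc : W.ciphers = V.ciphers.map (Cipher.shift δ))
    (hdec : o = none → ∀ e ∈ V.ciphers, (e.shift δ).dec = e.dec) :
    Indistinguishable o V W := by
  refine ⟨hs.symm, fun p q => ?_, fun e f => ?_⟩
  · rw [PlainRecipe.eval_shift hδ hp hc hdec, PlainRecipe.eval_shift hδ hp hc hdec]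
  · rw [(CipherRecipe.eval_shift hδ hp hc hdec e).1, (CipherRecipe.eval_shift hδ hp hc hdec f).1,
      Cipher.same_shift_iff]

theorem Event.shape_shift (δ : Agent n → ℕ → Vec n) (e : Event n) :
    (e.shift δ).shape = e.shape := by
  cases e <;> simp [Event.shift, Event.shape, Event.packet, Packet.shift, Msg.shift]

theorem Event.packet_shift (δ : Agent n → ℕ → Vec n) (e : Event n) :
    (e.shift δ).packet = e.packet.map (Packet.shift δ) := by
  cases e <;> rfl

/-- No agent with the same initial value in `v` and `w` can tell an execution on `v` from its
shift. -/
theorem Reachable.indistinguishable (h : SameResults c v w) {s : State n}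
    (hs : Reachable G c v s) {o : Agent n} (ho : ∀ i, o = some i → w i = v i) :
    Indistinguishable o (view o v s) (view o w (s.shift (inputShift c v w))) := by
  refine indistinguishable_of_shift (δ := inputShift c v w) ?_ (h.inputShift_eq_zero ho) ?_ ?_ ?_
  · simp [view, State.shift, Event.shape_shift]
  · simp only [view, State.shift, List.flatMap_map, Event.packet_shift, Option.map_map]
    congr 1
    cases o with
    | none => rfl
    | some i => simp [ho i rfl]
  · simp only [view, State.shift, List.flatMap_map, List.map_flatMap, Event.packet_shift,
      Option.map_map]
    congr 1
    funext e
    cases e.packet <;> rfl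
  -- what the trusted process receives are outputs of the Prepare phase, with equal decryptions
  · rintro rfl e he
    obtain ⟨ev, hev, he⟩ := List.mem_flatMap.1 he
    rcases hp : ev.packet with _ | p
    · simp [hp] at he
    rw [hp] at he
    obtain ⟨hok, hdst⟩ := hs.stateOk.log none ev hev p hp
    obtain ⟨ρ, hρ⟩ := hok.2 hdst
    obtain ⟨hok', -⟩ := (hs.shift h).stateOk.log none (ev.shift _) (List.mem_map_of_mem hev)
      (p.shift (inputShift c v w)) (by rw [Event.packet_shift, hp]; rfl)
    have := dec_shift_of_prepared h hok.1 hok'.1 hρ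
    rw [Msg.shift, List.map_map] at this
    exact List.map_inj_left.1 this e he

/-- What `o` has learned follows from its own initial value and the announced results. -/
theorem Learns.of_sameResults {s : State n} (hs : Reachable G c v s) {o : Agent n}
    {P : Vec n → Prop} (hP : Learns G c o v s P) (ho : ∀ i, o = some i → w i = v i)
    (h : SameResults c v w) : P w :=
  hP w _ (hs.shift h) (hs.indistinguishable h ho)

/-! ### Permuting the initial values -/

theorem mean_comp_perm (v : Vec n) (π : Equiv.Perm (Fin n)) : mean (fun i => v (π i)) = mean v := by
  simp only [mean, Equiv.sum_comp π v]

theorem variance_comp_perm (v : Vec n) (π : Equiv.Perm (Fin n)) :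
    variance (fun i => v (π i)) = variance v := by
  simp only [variance, mean_comp_perm]
  exact mean_comp_perm (fun i => (v i - mean v) ^ 2) π

theorem isOutlier_comp_perm (v : Vec n) (π : Equiv.Perm (Fin n)) (j : Fin n) :
    IsOutlier c (fun i => v (π i)) j ↔ IsOutlier c v (π j) := by
  simp only [IsOutlier, stdDev, mean_comp_perm, variance_comp_perm]

open Classical in
theorem sameResults_comp_perm (v : Vec n) (π : Equiv.Perm (Fin n)) :
    SameResults c v (fun i => v (π i)) := by
  refine ⟨(mean_comp_perm v π).symm, (variance_comp_perm v π).symm, ?_, ?_⟩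
  · simp only [keptMean, isOutlier_comp_perm]
    exact (mean_comp_perm (fun i => if IsOutlier c v i then 0 else v i) π).symm
  · simp only [keptFraction, isOutlier_comp_perm]
    exact (mean_comp_perm (fun i => if IsOutlier c v i then 0 else 1) π).symm

end OutlierConsensus

theorem theorem7 {n : ℕ} (G : SimpleGraph (Fin n)) (c : ℝ) (v : OutlierConsensus.Vec n)
    (s : OutlierConsensus.State n) (hs : OutlierConsensus.Reachable G c v s)
    (o : OutlierConsensus.Agent n) :
    -- if another process `j` holds an outlier and another process `k` does not, then `o` has
    -- learned neither of these facts
    (∀ j k : Fin n, o ≠ some j → o ≠ some k →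
      OutlierConsensus.IsOutlier c v j → ¬ OutlierConsensus.IsOutlier c v k →
        ¬ OutlierConsensus.Learns G c o v s (fun w => OutlierConsensus.IsOutlier c w j) ∧
        ¬ OutlierConsensus.Learns G c o v s (fun w => ¬ OutlierConsensus.IsOutlier c w k)) ∧
    -- for `o`, the outliers among the other processes may be distributed in any other way
    (∀ π : Equiv.Perm (Fin n), (∀ i, o = some i → π i = i) →
      ¬ OutlierConsensus.Learns G c o v s
        (fun w => ¬ ∀ j, OutlierConsensus.IsOutlier c w j ↔
          OutlierConsensus.IsOutlier c v (π j))) ∧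
    -- whatever `o` learns follows from its own initial value and the announced results
    (∀ P : OutlierConsensus.Vec n → Prop, OutlierConsensus.Learns G c o v s P →
      ∀ w : OutlierConsensus.Vec n, (∀ i, o = some i → w i = v i) →
        OutlierConsensus.SameResults c v w → P w) := by
  open OutlierConsensus in
  have hperm : ∀ π : Equiv.Perm (Fin n), (∀ i, o = some i → π i = i) → ∀ P : Vec n → Prop,
      Learns G c o v s P → P fun i => v (π i) := fun π hπ P hP =>
    hP.of_sameResults hs (fun i hi => congrArg v (hπ i hi)) (sameResults_comp_perm v π)
  have hswap : ∀ j k : Fin n, o ≠ some j → o ≠ some k → ∀ i, o = some i →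
      Equiv.swap j k i = i := fun j k hj hk i hi =>
    Equiv.swap_apply_of_ne_of_ne (fun h => hj (h ▸ hi)) fun h => hk (h ▸ hi)
  refine ⟨fun j k hj hk hvj hvk => ⟨fun hP => hvk ?_, fun hP => ?_⟩, fun π hπ hP => ?_,
    fun P hP w hw h => hP.of_sameResults hs hw h⟩
  · simpa [OutlierConsensus.isOutlier_comp_perm] using hperm _ (hswap j k hj hk) _ hP
  · have := hperm _ (hswap j k hj hk) _ hP
    simp [OutlierConsensus.isOutlier_comp_perm, hvj] at this
  · exact hperm π hπ _ hP fun j => OutlierConsensus.isOutlier_comp_perm v π j
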